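/- Let $n\ge 2$, let $V=\mathbb{F}_2^{2n}$ carry a symplectic (nondegenerate alternating bilinear) form $B$, and let $X=\mathrm{Sp}_{2n}(2)=\mathrm{Sp}(V,B)$ be its isometry group. For $\varepsilon\in\{+,-\}$ let $\mathcal{Q}^\varepsilon$ be the set of quadratic forms $\varphi:V\to\mathbb{F}_2$ of type $\varepsilon$ with $\varphi(x+y)-\varphi(x)-\varphi(y)=B(x,y)$ for all $x,y\in V$, where $\varphi$ has type $+$ (hyperbolic) if its Witt index (the largest dimension of a totally singular subspace) is $n$, and type $-$ (elliptic) if it is $n-1$. The group $X$ acts on $\mathcal{Q}^\varepsilon$ by $\varphi^g(x)=\varphi(xg^{-1})$. Let $2\le k\le|\mathcal{Q}^\varepsilon|-2$, and let $J(\mathcal{Q}^\varepsilon,k)$ be the Johnson graph, whose vertices are the $k$-subsets of $\mathcal{Q}^\varepsilon$, two of them being adjacent when they meet in $k-1$ points. Let $\Gamma$ be an $X$-strongly incidence-transitive code in $J(\mathcal{Q}^\varepsilon,k)$; that is, $\Gamma$ is a non-empty $X$-invariant set of vertices, $X$ is transitive on $\Gamma$, and for each $\Delta\in\Gamma$ the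 setwise stabiliser $X_\Delta$ is transitive on $\Delta\times(\mathcal{Q}^\varepsilon\setminus\Delta)$. Suppose that $\Delta\in\Gamma$ is such that $X_\Delta$ is irreducible on $V$. Then $X_\Delta$ is not contained in a maximal $\mathcal{C}_3$-subgroup of $X$. Here the maximal $\mathcal{C}_3$-subgroups of $X$ are the groups $\Gamma\mathrm{Sp}_{2m}(2^b)=\Gamma\mathrm{Sp}(W,\widetilde B)$ obtained as follows: $b$ is a prime, $W$ is a $2m$-dimensional vector space over $\mathbb{F}_{2^b}$ (so $n=mb$) with the same underlying additive group as $V$, $\widetilde B$ is a symplectic form on $W$ with $B=\mathrm{Tr}\circ\widetilde B$ for the absolute trace $\mathrm{Tr}:\mathbb{F}_{2^b}\to\mathbb{F}_2$, and $\Gamma\mathrm{Sp}(W,\widetilde B)$ consists of all bijections $g$ of $W$ for which there is $\sigma\in\mathrm{Aut}(\mathbb{F}_{2^b})$ such that $g$ is semilinear relative to $\sigma$ and $\widetilde B(ug,vg)=\widetilde B(u,v)^\sigma$ for all $u,v\in W$. -/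

import Mathlib

open scoped Pointwise

namespace SymplecticCodes

/-! ### Codes in Johnson graphs -/

section Johnson

/-- Vertices of the Johnson graph: the `k`-element subsets of a (finite) set `P`. -/
abbrev KSubset (P : Type*) (k : ℕ) : Type _ := {Δ : Set P // Δ.ncard = k}

/-- The Johnson graph `J(P, k)`: two `k`-subsets are adjacent iff they meet in `k - 1` points. -/
def johnsonGraph (P : Type*) (k : ℕ) : SimpleGraph (KSubset P k) where
  Adj Δ₁ Δ₂ := (Δ₁.1 ∩ Δ₂.1).ncard + 1 = k
  symm := ⟨fun Δ₁ Δ₂ h => by rwa [Set.inter_comm] at h⟩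
  loopless := ⟨fun Δ h => by
    rw [Set.inter_self, Δ.2] at h
    omega⟩

variable {G P : Type*} [Group G] [MulAction G P] {k : ℕ}

/-- The action of a group of permutations of `P` on the `k`-subsets of `P`. -/
instance : MulAction G (KSubset P k) where
  smul g Δ := ⟨g • Δ.1, by rw [Set.ncard_smul_set]; exact Δ.2⟩
  one_smul Δ := Subtype.ext (one_smul G Δ.1)
  mul_smul g h Δ := Subtype.ext (mul_smul g h Δ.1)

/-- Permutations of `P` induce automorphisms of the Johnson graph. -/
theorem johnsonGraph_adj_smul (g : G) (Δ₁ Δ₂ : KSubset P k) :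
    (johnsonGraph P k).Adj (g • Δ₁) (g • Δ₂) ↔ (johnsonGraph P k).Adj Δ₁ Δ₂ := by
  change (g • Δ₁.1 ∩ g • Δ₂.1).ncard + 1 = k ↔ (Δ₁.1 ∩ Δ₂.1).ncard + 1 = k
  rw [← Set.smul_set_inter, Set.ncard_smul_set]

variable (G) in
/-- A code `Γ` (non-empty set of vertices of `J(P, k)`) is `G`-strongly incidence-transitive, for a
group `G` acting on `P`: `G` leaves `Γ` invariant, is transitive on `Γ`, and for every codeword `Δ`
the setwise stabiliser of `Δ` is transitive on `Δ × (P ∖ Δ)`. -/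
structure IsStronglyIncidenceTransitive (Γ : Set (KSubset P k)) : Prop where
  nonempty : Γ.Nonempty
  invariant : ∀ (g : G), ∀ Δ ∈ Γ, g • Δ ∈ Γ
  transitive : ∀ Δ₁ ∈ Γ, ∀ Δ₂ ∈ Γ, ∃ g : G, g • Δ₁ = Δ₂
  incidence_transitive : ∀ Δ ∈ Γ,
    ∀ p₁ ∈ Δ.1, ∀ q₁ ∉ Δ.1, ∀ p₂ ∈ Δ.1, ∀ q₂ ∉ Δ.1,
      ∃ g ∈ MulAction.stabilizer G Δ, g • p₁ = p₂ ∧ g • q₁ = q₂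

end Johnson

/-! ### Symplectic groups and their actions on quadratic forms -/

section Symplectic

variable {F V : Type*} [Field F] [AddCommGroup V] [Module F V]

/-- A symplectic form: a nondegenerate alternating bilinear form. -/
def IsSymplectic (B : LinearMap.BilinForm F V) : Prop := B.Nondegenerate ∧ B.IsAlt

/-- The isometry group of a bilinear form; for a symplectic form `B` this is `Sp(V, B)`. -/
def Sp (B : LinearMap.BilinForm F V) : Subgroup (V ≃ₗ[F] V) where
  carrier := {g | ∀ u v, B (g u) (g v) = B u v}
  one_mem' _ _ := rfl
  mul_mem' {g h} hg hh u v := (hg (h u) (h v)).trans (hh u v)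
  inv_mem' {g} hg u v := by
    have hi : ∀ w, g (g⁻¹ w) = w := fun w => g.apply_symm_apply w
    have h := hg (g⁻¹ u) (g⁻¹ v)
    rw [hi, hi] at h
    exact h.symm

/-- `d` is the Witt index of `φ`: the largest dimension of a totally singular subspace. -/
def HasWittIndex (φ : QuadraticForm F V) (d : ℕ) : Prop :=
  IsGreatest {r | ∃ U : Submodule F V, (∀ u ∈ U, φ u = 0) ∧ Module.finrank F U = r} d

/-- The two types `+` and `-` of quadratic forms. -/
inductive FormType
  | plus
  | minus

/-- The type of a quadratic form with nondegenerate polar form on a space of dimension `2n` over a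
finite field: `+` (hyperbolic) if the Witt index is `n`, and `-` (elliptic) if it is `n - 1`. -/
def HasType (φ : QuadraticForm F V) : FormType → Prop
  | .plus => ∃ d, HasWittIndex φ d ∧ Module.finrank F V = 2 * d
  | .minus => ∃ d, HasWittIndex φ d ∧ Module.finrank F V = 2 * (d + 1)

/-- The set `𝒬^ε` of quadratic forms of type `ε` polarising to `B`. -/
def quadForms (B : LinearMap.BilinForm F V) (ε : FormType) : Set (QuadraticForm F V) :=
  {φ | (∀ u v, φ (u + v) - φ u - φ v = B u v) ∧ HasType φ ε}

/-- The image of a quadratic form under `g`, namely `x ↦ φ (g⁻¹ x)`. -/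
def translate (g : V ≃ₗ[F] V) (φ : QuadraticForm F V) : QuadraticForm F V :=
  φ.comp (g⁻¹ : V ≃ₗ[F] V).toLinearMap

theorem translate_apply (g : V ≃ₗ[F] V) (φ : QuadraticForm F V) (x : V) :
    translate g φ x = φ (g⁻¹ x) := rfl

theorem HasWittIndex.translate {φ : QuadraticForm F V} {d : ℕ} (h : HasWittIndex φ d)
    (g : V ≃ₗ[F] V) : HasWittIndex (translate g φ) d := by
  have key : {r | ∃ U : Submodule F V, (∀ u ∈ U, SymplecticCodes.translate g φ u = 0) ∧
        Module.finrank F U = r} =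
      {r | ∃ U : Submodule F V, (∀ u ∈ U, φ u = 0) ∧ Module.finrank F U = r} := by
    ext r
    constructor
    · rintro ⟨U, hU, rfl⟩
      refine ⟨U.map (g⁻¹ : V ≃ₗ[F] V).toLinearMap, ?_, LinearEquiv.finrank_map_eq _ _⟩
      rintro _ ⟨u, hu, rfl⟩
      exact hU u hu
    · rintro ⟨U, hU, rfl⟩
      refine ⟨U.map g.toLinearMap, ?_, LinearEquiv.finrank_map_eq _ _⟩
      rintro _ ⟨u, hu, rfl⟩
      exact (congrArg φ (g.symm_apply_apply u)).trans (hU u hu)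
  unfold HasWittIndex
  rw [key]
  exact h

theorem HasType.translate {φ : QuadraticForm F V} {ε : FormType} (h : HasType φ ε)
    (g : V ≃ₗ[F] V) : HasType (translate g φ) ε := by
  cases ε <;> exact ⟨h.choose, h.choose_spec.1.translate g, h.choose_spec.2⟩

theorem translate_mem_quadForms {B : LinearMap.BilinForm F V} {ε : FormType} {g : V ≃ₗ[F] V}
    (hg : g ∈ Sp B) {φ : QuadraticForm F V} (hφ : φ ∈ quadForms B ε) :
    translate g φ ∈ quadForms B ε := by
  refine ⟨fun u v => ?_, hφ.2.translate g⟩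
  have hi : B (g⁻¹ u) (g⁻¹ v) = B u v := (Sp B).inv_mem hg u v
  simp only [translate_apply, map_add]
  rw [hφ.1, hi]

/-- The (Jordan–Steiner) action of `Sp(V, B)` on `𝒬^ε`, given by `(g • φ)(x) = φ (g⁻¹ x)`. -/
instance (B : LinearMap.BilinForm F V) (ε : FormType) : MulAction (Sp B) (quadForms B ε) where
  smul g φ := ⟨translate g.1 φ.1, translate_mem_quadForms g.2 φ.2⟩
  one_smul _ := rfl
  mul_smul g h φ := Subtype.ext (by
    change translate (g.1 * h.1) φ.1 = translate g.1 (translate h.1 φ.1)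
    ext x
    simp only [translate_apply, mul_inv_rev, LinearEquiv.mul_apply])

theorem smul_quadForms_apply {B : LinearMap.BilinForm F V} {ε : FormType} (g : Sp B)
    (φ : quadForms B ε) (x : V) : (g • φ).1 x = φ.1 (g.1⁻¹ x) := rfl

/-- A group of linear transformations is irreducible on `V`: `V ≠ 0`, and `0` and `V` are the only
invariant subspaces. -/
def IsIrreducibleOn (H : Subgroup (V ≃ₗ[F] V)) : Prop :=
  Nontrivial V ∧
    ∀ U : Submodule F V, (∀ g ∈ H, ∀ u ∈ U, g u ∈ U) → U = ⊥ ∨ U = ⊤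

end Symplectic

/-! ### The subgroups of class `C₃` -/

section ExtensionField

variable {V : Type*} [AddCommGroup V] [Module (ZMod 2) V]

/-- The group `ΓSp(W, B')` of all semi-isometries of a bilinear form `B'` on a `K`-vector space
`W`: bijections `g` of `W` that are semilinear relative to some field automorphism `σ` of `K` and
satisfy `B' (g u) (g v) = σ (B' u v)`. Here `W` is the `𝔽₂`-space `V` with a further scalar
multiplication by `K`, and the group is regarded as a group of `𝔽₂`-linear maps of `V` (every
additive map of `V` is `𝔽₂`-linear). -/
def GammaSp {K : Type*} [Field K] [Module K V] (B' : LinearMap.BilinForm K V) :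
    Subgroup (V ≃ₗ[ZMod 2] V) where
  carrier := {g | ∃ σ : K ≃+* K, (∀ (a : K) (v : V), g (a • v) = σ a • g v) ∧
    ∀ u v, B' (g u) (g v) = σ (B' u v)}
  one_mem' := ⟨RingEquiv.refl K, fun _ _ => rfl, fun _ _ => rfl⟩
  mul_mem' := by
    rintro g h ⟨σ, hσ, hσ'⟩ ⟨τ, hτ, hτ'⟩
    refine ⟨τ.trans σ, fun a v => ?_, fun u v => ?_⟩
    · simp only [LinearEquiv.mul_apply, hτ, hσ, RingEquiv.trans_apply]
    · simp only [LinearEquiv.mul_apply, hτ', hσ', RingEquiv.trans_apply]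
  inv_mem' := by
    rintro g ⟨σ, hσ, hσ'⟩
    have hg : ∀ v, g (g⁻¹ v) = v := fun v => g.apply_symm_apply v
    refine ⟨σ.symm, fun a v => g.injective ?_, fun u v => σ.injective ?_⟩
    · rw [hσ, hg, hg, RingEquiv.apply_symm_apply]
    · rw [← hσ', hg, hg, RingEquiv.apply_symm_apply]

/-- If `B` is the composite of a form `B'` over `K` with the absolute trace of the field `K`, then
every semi-isometry of `B'` is an isometry of `B`. -/
theorem GammaSp_le_Sp {K : Type*} [Field K] [Algebra (ZMod 2) K] [Module K V]
    (B' : LinearMap.BilinForm K V) (B : LinearMap.BilinForm (ZMod 2) V)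
    (hB : ∀ u v, B u v = Algebra.trace (ZMod 2) K (B' u v)) : GammaSp B' ≤ Sp B := by
  rintro g ⟨σ, -, hσ⟩ u v
  rw [hB, hB, hσ]
  exact Algebra.trace_eq_of_algEquiv (AlgEquiv.ofRingEquiv (f := σ) fun r =>
    RingHom.congr_fun (Subsingleton.elim
      ((σ : K →+* K).comp (algebraMap (ZMod 2) K)) (algebraMap (ZMod 2) K)) r) _

/-- The maximal `C₃`-subgroups `ΓSp_{2m}(2^b)` of `Sp(V, B)`, where `B` is a symplectic form on the
`𝔽₂`-space `V`. There is a prime `b` and a structure of a `2m`-dimensional vector space `W` over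
`𝔽_{2^b}` on the additive group of `V` (its restriction to `𝔽₂` is then the given one), together
with a symplectic form `B'` on `W` such that `B = Tr ∘ B'` for the absolute trace
`Tr : 𝔽_{2^b} → 𝔽₂`, and the subgroup is the group of semi-isometries of `B'`. -/
def IsMaximalC3Subgroup (B : LinearMap.BilinForm (ZMod 2) V) (M : Subgroup (Sp B)) : Prop :=
  ∃ b m : ℕ, b.Prime ∧
    ∃ (_ : Module (GaloisField 2 b) V) (B' : LinearMap.BilinForm (GaloisField 2 b) V),
      Module.finrank (GaloisField 2 b) V = 2 * m ∧ IsSymplectic B' ∧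
      (∀ u v, B u v = Algebra.trace (ZMod 2) (GaloisField 2 b) (B' u v)) ∧
      M = (GammaSp B').subgroupOf (Sp B)

end ExtensionField

end SymplecticCodes

/-!
Suppose that the stabiliser `X_Δ` lies in `ΓSp(W, B')`, where `W` is a space over `K = 𝔽_q`,
`q = 2 ^ b`. Each `φ ∈ 𝒬^ε` is `Tr ∘ Q` for a unique `K`-quadratic form `Q` polarising to `B'`, its
*lift* (`IsTraceLift`), and the passage from `φ` to `Q` commutes with semi-isometries. Two forms
in `𝒬^ε` are `φ` and `φ + B c` for a vector `c` with `φ c = 0` (`exists_diff`,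
`apply_diff_eq_zero`), and conversely `φ c = 0` implies `φ + B c ∈ 𝒬^ε`, by a transvection
(`exists_translate_eq_add`). That forms of the same type differ by singular vectors only follows
from the sign of the Gauss sum `∑ₓ (-1) ^ φ x`.

Call `Q c` the *colour* of the pair `φ`, `φ + B c`. Since `X_Δ` is transitive on pairs separated
by `Δ`, all these pairs have the same colour up to `Aut K`. If `φ ∈ Δ`, `φ + B c ∉ Δ` and `Q d`
has trace zero, then `φ + B d ∈ 𝒬^ε` forms a separated pair with one of the two, so that `Q d` or
`Q c + Q d + β + β ^ 2`, `β = B' c d`, is in the `Aut K`-orbit of `Q c` (`colour_intermediate`).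
Suitable choices of `d` show that `Q c ≠ 0` (`colour_ne_zero`), that `Q` is anisotropic
(`anisotropic_of_colour`), whence `W` is a plane, and that `b < 5` (`natCard_le_of_anisotropic`).

This leaves `b = 2` and `b = 3`, where the Gauss sum of the anisotropic form gives `|𝒬^ε| = 6` and
`|𝒬^ε| = 28`. By incidence transitivity `k (|𝒬^ε| - k)` divides `|X_Δ|`, hence `b q (q ^ 2 - 1)`
(`natCard_GammaSp_dvd`), that is, `120` or `1512`. The only solutions have `|𝒬^ε| = 6` and `k = 2`
or `k = 4`; then `X_Δ` preserves a pair `{φ, φ + B c}` and fixes `c`, so it is not irreducible.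
-/

namespace SymplecticCodes

/-! ### Traces in finite fields of characteristic two -/

section Field

variable {K : Type*} [Field K] [Algebra (ZMod 2) K]

theorem charTwo_of_algebra (K : Type*) [Field K] [Algebra (ZMod 2) K] : CharP K 2 :=
  charP_of_injective_algebraMap (algebraMap (ZMod 2) K).injective 2

theorem trace_ringEquiv (σ : K ≃+* K) (x : K) :
    Algebra.trace (ZMod 2) K (σ x) = Algebra.trace (ZMod 2) K x :=
  Algebra.trace_eq_of_algEquiv (AlgEquiv.ofRingEquiv (f := σ) fun r =>
    RingHom.congr_fun (Subsingleton.elim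
      ((σ : K →+* K).comp (algebraMap (ZMod 2) K)) (algebraMap (ZMod 2) K)) r) _

variable [Finite K]

theorem trace_sq (x : K) : Algebra.trace (ZMod 2) K (x ^ 2) = Algebra.trace (ZMod 2) K x := by
  have := charTwo_of_algebra K
  simpa [frobenius_def] using trace_ringEquiv (frobeniusEquiv K 2) x

theorem exists_sq_eq (x : K) : ∃ y : K, y ^ 2 = x := by
  have := charTwo_of_algebra K
  obtain ⟨y, hy⟩ := (frobeniusEquiv K 2).surjective x
  exact ⟨y, by simpa [frobenius_def] using hy⟩

/-- The additive form of Hilbert's Theorem 90: the kernel of the trace consists of the elements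
`β + β ^ 2`, since both are hyperplanes of `K` over `𝔽₂`. -/
theorem exists_add_sq_eq {x : K} (hx : Algebra.trace (ZMod 2) K x = 0) :
    ∃ β : K, β + β ^ 2 = x := by
  have := charTwo_of_algebra K
  let f : K →ₗ[ZMod 2] K := AddMonoidHom.toZModLinearMap 2
    { toFun := fun β : K => β + β ^ 2
      map_zero' := by simp
      map_add' := fun a b => by rw [CharTwo.add_sq]; ring }
  have hf : ∀ a, f a = a + a ^ 2 := fun _ => rfl
  have hker : LinearMap.ker f = Submodule.span (ZMod 2) {(1 : K)} := by
    ext a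
    rw [LinearMap.mem_ker, hf, Submodule.mem_span_singleton]
    constructor
    · intro h
      have : a * (a + 1) = 0 := by rw [← h]; ring
      rcases mul_eq_zero.1 this with h | h
      · exact ⟨0, by simp [h]⟩
      · exact ⟨1, by rw [one_smul]; exact (CharTwo.add_eq_zero.1 h).symm⟩
    · rintro ⟨c, rfl⟩
      rcases (show ∀ u : ZMod 2, u = 0 ∨ u = 1 by decide) c with rfl | rfl
      · simp
      · simp [CharTwo.add_self_eq_zero]
  have hle : LinearMap.range f ≤ LinearMap.ker (Algebra.trace (ZMod 2) K) := by
    rintro _ ⟨a, rfl⟩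
    rw [LinearMap.mem_ker, hf, map_add, trace_sq, CharTwo.add_self_eq_zero]
  have h1 := LinearMap.finrank_range_add_finrank_ker f
  have h2 := LinearMap.finrank_range_add_finrank_ker (Algebra.trace (ZMod 2) K)
  rw [hker, finrank_span_singleton one_ne_zero] at h1
  rw [LinearMap.range_eq_top.2 (Algebra.trace_surjective (ZMod 2) K), finrank_top,
    Module.finrank_self] at h2
  have heq := Submodule.eq_of_le_of_finrank_eq hle (by omega)
  have hx' : x ∈ LinearMap.range f := heq ▸ LinearMap.mem_ker.2 hx
  exact hx'

theorem eq_zero_of_trace_sq_mul {y : K}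
    (h : ∀ a : K, Algebra.trace (ZMod 2) K (a ^ 2 * y) = 0) : y = 0 := by
  refine (traceForm_nondegenerate (ZMod 2) K).1 y fun a => ?_
  obtain ⟨c, rfl⟩ := exists_sq_eq a
  rw [Algebra.traceForm_apply, mul_comm, h]

theorem ext_trace_sq_mul {y z : K}
    (h : ∀ a : K, Algebra.trace (ZMod 2) K (a ^ 2 * y) = Algebra.trace (ZMod 2) K (a ^ 2 * z)) :
    y = z :=
  sub_eq_zero.1 <| eq_zero_of_trace_sq_mul fun a => by rw [mul_sub, map_sub, h, sub_self]

/-- Every additive functional of `K` is of the form `a ↦ Tr (a² y)`: these functionals depend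
injectively on `y`, and there are as many of them as there are elements of `K`. -/
theorem exists_trace_sq_mul (f : K →ₗ[ZMod 2] ZMod 2) :
    ∃ y : K, ∀ a, Algebra.trace (ZMod 2) K (a ^ 2 * y) = f a := by
  have := charTwo_of_algebra K
  let g : K →ₗ[ZMod 2] Module.Dual (ZMod 2) K := AddMonoidHom.toZModLinearMap 2
    { toFun := fun y => AddMonoidHom.toZModLinearMap 2
        { toFun := fun a : K => Algebra.trace (ZMod 2) K (a ^ 2 * y)
          map_zero' := by simp
          map_add' := fun a b => by rw [CharTwo.add_sq, add_mul, map_add] }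
      map_zero' := by ext; simp
      map_add' := fun a b => by
        ext c
        simp [mul_add] }
  have hg : ∀ y a, g y a = Algebra.trace (ZMod 2) K (a ^ 2 * y) := fun _ _ => rfl
  have hinj : Function.Injective g := fun y z h =>
    ext_trace_sq_mul fun a => by rw [← hg, ← hg, h]
  obtain ⟨y, hy⟩ := (LinearMap.injective_iff_surjective_of_finrank_eq_finrank
    (Subspace.dual_finrank_eq (K := ZMod 2) (V := K)).symm).1 hinj f
  exact ⟨y, fun a => by rw [← hg, hy]⟩

/-- The trace takes each of its two values equally often. -/
theorem two_mul_ncard_trace_eq (c : ZMod 2) :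
    2 * {x : K | Algebra.trace (ZMod 2) K x = c}.ncard = Nat.card K := by
  obtain ⟨t, ht⟩ := Algebra.trace_surjective (ZMod 2) K 1
  have hcompl : {x : K | Algebra.trace (ZMod 2) K x = c}ᶜ =
      (fun x => x + t) '' {x : K | Algebra.trace (ZMod 2) K x = c} := by
    have key : ∀ u v : ZMod 2, ¬ u = v ↔ u - 1 = v := by decide
    ext x
    simp only [Set.mem_compl_iff, Set.mem_ofPred_eq, Set.mem_image]
    rw [key]
    constructor
    · exact fun h => ⟨x - t, by rw [map_sub, ht, h], by ring⟩
    · rintro ⟨y, hy, rfl⟩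
      rw [map_add, ht, hy, add_sub_cancel_right]
  have := Set.ncard_add_ncard_compl {x : K | Algebra.trace (ZMod 2) K x = c}
  rw [hcompl, Set.ncard_image_of_injective _ (add_left_injective t)] at this
  omega

theorem natCard_ringAut (K : Type*) [Field K] [Finite K] [Algebra (ZMod 2) K] :
    Nat.card (K ≃+* K) = Module.finrank (ZMod 2) K := by
  rw [← IsGalois.card_aut_eq_finrank]
  refine Nat.card_congr
    { toFun := fun σ => AlgEquiv.ofRingEquiv (f := σ) fun r =>
        RingHom.congr_fun (Subsingleton.elim
          ((σ : K →+* K).comp (algebraMap (ZMod 2) K)) (algebraMap (ZMod 2) K)) r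
      invFun := fun σ => σ.toRingEquiv
      left_inv := fun _ => rfl
      right_inv := fun _ => rfl }


end Field

/-! ### Gauss sums and the type of a quadratic form over the field of two elements -/

section GaussSum

/-- The nontrivial additive character of `𝔽₂`, with integer values. -/
def sgn (a : ZMod 2) : ℤ := if a = 0 then 1 else -1

@[simp] theorem sgn_zero : sgn 0 = 1 := rfl

@[simp] theorem sgn_one : sgn 1 = -1 := rfl

theorem sgn_add : ∀ a b : ZMod 2, sgn (a + b) = sgn a * sgn b := by decide

theorem sum_sgn_eq_zero {A : Type*} [AddCommGroup A] [Module (ZMod 2) A] [Fintype A]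
    {f : A →ₗ[ZMod 2] ZMod 2} (hf : f ≠ 0) : ∑ a, sgn (f a) = 0 := by
  obtain ⟨t, ht⟩ : ∃ t, f t ≠ 0 := by
    by_contra! h
    exact hf (LinearMap.ext h)
  have h1 : f t = 1 := by
    have : ∀ u : ZMod 2, u ≠ 0 → u = 1 := by decide
    exact this _ ht
  have h2 : ∑ a, sgn (f a) = ∑ a, sgn (f (a + t)) :=
    (Fintype.sum_equiv (Equiv.addRight t) _ _ fun _ => rfl).symm
  simp only [map_add, sgn_add, h1, sgn_one, mul_neg, mul_one, Finset.sum_neg_distrib] at h2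
  omega

variable {V : Type*} [AddCommGroup V] [Module (ZMod 2) V] [Fintype V]

/-- The Gauss sum `∑ₓ (-1) ^ φ x` of a quadratic form over `𝔽₂`. Its sign tells the type of a
nondegenerate form. -/
def gaussSum2 (φ : QuadraticForm (ZMod 2) V) : ℤ := ∑ x, sgn (φ x)

open Classical in
/-- The Gauss sum is supported on the perpendicular space of any totally singular subspace. -/
theorem gaussSum2_eq_sum_orthogonal {B : LinearMap.BilinForm (ZMod 2) V}
    {φ : QuadraticForm (ZMod 2) V} (hφ : ∀ u v, φ (u + v) - φ u - φ v = B u v)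
    {U : Submodule (ZMod 2) V} (hU : ∀ u ∈ U, φ u = 0) :
    gaussSum2 φ = ∑ x, if (∀ u ∈ U, B x u = 0) then sgn (φ x) else 0 := by
  have hadd : ∀ u v, φ (u + v) = φ u + φ v + B u v := fun u v => by rw [← hφ]; ring
  -- Shifting the summation variable by a singular vector `u` introduces the character `B · u`.
  have h1 : ∀ u : U, gaussSum2 φ = ∑ x, sgn (φ x) * sgn (B x u) := by
    intro u
    have : gaussSum2 φ = ∑ x, sgn (φ (x + u)) :=
      (Fintype.sum_equiv (Equiv.addRight (u : V)) _ _ fun _ => rfl).symm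
    rw [this]
    refine Finset.sum_congr rfl fun x _ => ?_
    rw [hadd, hU u u.2, add_zero, sgn_add]
  -- Orthogonality of characters on `U`.
  have h2 : ∀ x, ∑ u : U, sgn (B x u) =
      if (∀ u ∈ U, B x u = 0) then (Fintype.card U : ℤ) else 0 := by
    intro x
    split_ifs with h
    · rw [Finset.sum_congr rfl fun u _ => by rw [h u u.2, sgn_zero]]
      simp
    · refine sum_sgn_eq_zero (f := (B x).comp U.subtype) fun h0 => h fun u hu => ?_
      exact LinearMap.congr_fun h0 ⟨u, hu⟩
  have h3 : (Fintype.card U : ℤ) * gaussSum2 φ =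
      Fintype.card U * ∑ x, if (∀ u ∈ U, B x u = 0) then sgn (φ x) else 0 := by
    calc (Fintype.card U : ℤ) * gaussSum2 φ = ∑ u : U, gaussSum2 φ := by simp
      _ = ∑ u : U, ∑ x, sgn (φ x) * sgn (B x u) := Finset.sum_congr rfl fun u _ => h1 u
      _ = ∑ x, sgn (φ x) * ∑ u : U, sgn (B x u) := by
          rw [Finset.sum_comm]
          simp only [Finset.mul_sum]
      _ = _ := by
          rw [Finset.mul_sum]
          refine Finset.sum_congr rfl fun x _ => ?_
          rw [h2]
          split_ifs <;> ring
  exact mul_left_cancel₀ (by exact_mod_cast Fintype.card_ne_zero) h3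

/-- Translating a form by `B c` multiplies its Gauss sum by `(-1) ^ φ c`. -/
theorem gaussSum2_add {B : LinearMap.BilinForm (ZMod 2) V}
    {φ ψ : QuadraticForm (ZMod 2) V} (hφ : ∀ u v, φ (u + v) - φ u - φ v = B u v)
    {c : V} (hψ : ∀ x, ψ x = φ x + B c x) : gaussSum2 ψ = sgn (φ c) * gaussSum2 φ := by
  have : gaussSum2 φ = ∑ x, sgn (φ (c + x)) :=
    (Fintype.sum_equiv (Equiv.addLeft c) _ _ fun _ => rfl).symm
  rw [this, Finset.mul_sum]
  refine Finset.sum_congr rfl fun x _ => ?_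
  rw [← sgn_add, hψ, ← hφ c x]
  congr 1
  have : ∀ a b c : ZMod 2, b + (a - c - b) = c + a := by decide
  exact this _ _ _

/-- A nondegenerate form of type `+` has positive Gauss sum, one of type `-` negative Gauss sum.
With `U` a maximal totally singular subspace, the sum runs over `U` in the first case, and in
the second over `U^⊥`, where the form vanishes only on the subspace `U` of index `4`. -/
theorem gaussSum2_sign {B : LinearMap.BilinForm (ZMod 2) V} (hB : IsSymplectic B)
    {φ : QuadraticForm (ZMod 2) V} (hφ : ∀ u v, φ (u + v) - φ u - φ v = B u v) (ε : FormType)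
    (hε : HasType φ ε) :
    match ε with
    | .plus => 0 < gaussSum2 φ
    | .minus => gaussSum2 φ < 0 := by
  classical
  have hrefl : B.IsRefl := hB.2.isRefl
  have hmem : ∀ (U : Submodule (ZMod 2) V) x, x ∈ B.orthogonal U ↔ ∀ u ∈ U, B x u = 0 := by
    intro U x
    rw [LinearMap.BilinForm.mem_orthogonal_iff]
    exact forall₂_congr fun u _ => ⟨fun h => hrefl _ _ h, fun h => hrefl _ _ h⟩
  have hle : ∀ U : Submodule (ZMod 2) V, (∀ u ∈ U, φ u = 0) → U ≤ B.orthogonal U := by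
    intro U hU x hx
    rw [hmem]
    intro u hu
    rw [← hφ, hU x hx, hU u hu, hU _ (U.add_mem hx hu)]
    simp
  have hdim : ∀ U : Submodule (ZMod 2) V, Module.finrank (ZMod 2) (B.orthogonal U) =
      Module.finrank (ZMod 2) V - Module.finrank (ZMod 2) U :=
    fun U => LinearMap.BilinForm.finrank_orthogonal hB.1 U
  have hcard : ∀ U : Submodule (ZMod 2) V,
      Fintype.card U = 2 ^ Module.finrank (ZMod 2) U := fun U => by
    simpa using Module.card_eq_pow_finrank (K := ZMod 2) (V := U)
  cases ε with
  | plus =>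
    obtain ⟨d, ⟨⟨U, hU, hUd⟩, -⟩, hd⟩ := hε
    have heq : U = B.orthogonal U :=
      Submodule.eq_of_le_of_finrank_eq (hle U hU) (by rw [hdim]; omega)
    rw [gaussSum2_eq_sum_orthogonal hφ hU]
    refine Finset.sum_pos' (fun x _ => ?_) ⟨0, Finset.mem_univ _, ?_⟩
    · split_ifs with h
      · rw [hU x (heq ▸ (hmem U x).2 h), sgn_zero]
        norm_num
      · rfl
    · simp
  | minus =>
    obtain ⟨d, ⟨⟨U, hU, hUd⟩, hmax⟩, hd⟩ := hε
    have hone : ∀ x, x ∈ B.orthogonal U → x ∉ U → φ x = 1 := by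
      intro x hx hxU
      by_contra h
      have h0 : φ x = 0 := by
        have : ∀ u : ZMod 2, u ≠ 1 → u = 0 := by decide
        exact this _ h
      -- Otherwise adjoining `x` gives a larger totally singular subspace.
      have hlt : U < U ⊔ Submodule.span (ZMod 2) {x} :=
        lt_of_le_of_ne le_sup_left fun he => hxU <| he ▸
          Submodule.mem_sup_right (Submodule.mem_span_singleton_self x)
      have h1 := Submodule.finrank_lt_finrank_of_lt hlt
      have h2 : Module.finrank (ZMod 2) ↥(U ⊔ Submodule.span (ZMod 2) {x}) ≤ d := by
        refine hmax ⟨_, fun u hu => ?_, rfl⟩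
        obtain ⟨y, hy, z, hz, rfl⟩ := Submodule.mem_sup.1 hu
        obtain ⟨c, rfl⟩ := Submodule.mem_span_singleton.1 hz
        have := hφ y (c • x)
        rw [hU y hy, QuadraticMap.map_smul, h0, map_smul, hrefl _ _ ((hmem U x).1 hx y hy)] at this
        simpa using this
      omega
    rw [gaussSum2_eq_sum_orthogonal hφ hU]
    have hval : ∀ x, (if (∀ u ∈ U, B x u = 0) then sgn (φ x) else 0) =
        2 * (if x ∈ U then 1 else 0) - (if x ∈ B.orthogonal U then 1 else 0) := by
      intro x
      simp only [← hmem U x]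
      by_cases hx : x ∈ U
      · simp [hx, hle U hU hx, hU x hx]
      · by_cases hx' : x ∈ B.orthogonal U
        · simp [hx, hx', hone x hx' hx]
        · simp [hx, hx']
    rw [Finset.sum_congr rfl fun x _ => hval x, Finset.sum_sub_distrib, ← Finset.mul_sum,
      Finset.sum_boole, Finset.sum_boole, ← Fintype.card_subtype, ← Fintype.card_subtype]
    have e1 := hcard U
    have e2 := hcard (B.orthogonal U)
    rw [hUd] at e1
    rw [hdim, hUd, hd, show 2 * (d + 1) - d = d + 2 by omega, pow_add] at e2
    have e3 : 0 < 2 ^ d := by positivity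
    have e4 : (Fintype.card {x // x ∈ U}) = 2 ^ d := e1
    have e5 : (Fintype.card {x // x ∈ B.orthogonal U}) = 2 ^ d * 2 ^ 2 := e2
    rw [e4, e5]
    push_cast
    have e6 : (0 : ℤ) < 2 ^ d := by positivity
    linarith

theorem gaussSum2_mul_pos {B : LinearMap.BilinForm (ZMod 2) V} (hB : IsSymplectic B)
    {ε : FormType} {φ ψ : QuadraticForm (ZMod 2) V}
    (hφ : φ ∈ quadForms B ε) (hψ : ψ ∈ quadForms B ε) : 0 < gaussSum2 φ * gaussSum2 ψ := by
  have h1 := gaussSum2_sign hB hφ.1 ε hφ.2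
  have h2 := gaussSum2_sign hB hψ.1 ε hψ.2
  cases ε
  · exact mul_pos h1 h2
  · exact mul_pos_of_neg_of_neg h1 h2

end GaussSum

/-! ### The set of quadratic forms of one type as an affine quadric -/

section QuadForms

variable {V : Type*} [AddCommGroup V] [Module (ZMod 2) V]
  {B : LinearMap.BilinForm (ZMod 2) V} {ε : FormType}

theorem quadForms_add (φ : quadForms B ε) (u v : V) : φ.1 (u + v) = φ.1 u + φ.1 v + B u v := by
  rw [← φ.2.1]; ring

theorem diff_unique (hB : IsSymplectic B) {c d : V} (h : ∀ x, B c x = B d x) : c = d := by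
  refine sub_eq_zero.1 (hB.1.1 _ fun x => ?_)
  rw [map_sub, LinearMap.sub_apply, h, sub_self]

/-- If `φ d = 0`, then `φ + B d` is the image of `φ` under a transvection, so has the same type. -/
theorem exists_translate_eq_add (hB : IsSymplectic B) (φ : quadForms B ε) {d : V}
    (hd : φ.1 d = 0) : ∃ ψ : quadForms B ε, ∀ x, ψ.1 x = φ.1 x + B d x := by
  have hT : ∀ x, LinearEquiv.transvection (hB.2 d) x = x + B d x • d := fun _ => rfl
  have hsymm : ∀ u v, B u v = B v u := fun u v => by
    rw [← hB.2.neg_eq u v, ZMod.neg_eq_self_mod_two]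
  have hmem : LinearEquiv.transvection (hB.2 d) ∈ Sp B := by
    intro u v
    rw [hT, hT]
    simp only [map_add, LinearMap.add_apply, map_smul, LinearMap.smul_apply, smul_eq_mul, hB.2 d,
      hsymm u d]
    have : ∀ a b c : ZMod 2, a + b * c + c * (b + b * 0) = a := by decide
    exact this _ _ _
  refine ⟨⟨translate (LinearEquiv.transvection (hB.2 d))⁻¹ φ.1,
    translate_mem_quadForms ((Sp B).inv_mem hmem) φ.2⟩, fun x => ?_⟩
  rw [translate_apply, inv_inv, hT, quadForms_add, QuadraticMap.map_smul, hd, map_smul, hsymm x d]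
  have : ∀ a b : ZMod 2, a + b * b * 0 + b * b = a + b := by decide
  exact this _ _

variable [Finite V]

theorem exists_diff (hB : IsSymplectic B) (φ ψ : quadForms B ε) :
    ∃ c : V, ∀ x, ψ.1 x = φ.1 x + B c x := by
  let f : V →ₗ[ZMod 2] ZMod 2 := AddMonoidHom.toZModLinearMap 2
    { toFun := fun x => ψ.1 x - φ.1 x
      map_zero' := by simp
      map_add' := fun x y => by rw [quadForms_add, quadForms_add]; ring }
  refine ⟨(LinearMap.BilinForm.toDual B hB.1).symm f, fun x => ?_⟩
  rw [LinearMap.BilinForm.apply_toDual_symm_apply]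
  change _ = φ.1 x + (ψ.1 x - φ.1 x)
  ring

/-- Two forms of the same type differ by `B c` for a vector `c` singular for both. -/
theorem apply_diff_eq_zero (hB : IsSymplectic B) {φ ψ : quadForms B ε} {c : V}
    (h : ∀ x, ψ.1 x = φ.1 x + B c x) : φ.1 c = 0 := by
  have := Fintype.ofFinite V
  have h1 := gaussSum2_mul_pos hB φ.2 ψ.2
  rw [gaussSum2_add φ.2.1 h] at h1
  by_contra h0
  have : ∀ u : ZMod 2, u ≠ 0 → u = 1 := by decide
  rw [this _ h0, sgn_one] at h1
  nlinarith [mul_self_nonneg (gaussSum2 φ.1)]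

/-- The forms of the type of `φ` correspond to the singular vectors of `φ`. -/
theorem natCard_quadForms (hB : IsSymplectic B) (φ : quadForms B ε) :
    Nat.card (quadForms B ε) = {c | φ.1 c = 0}.ncard := by
  choose f hf using fun ψ => exists_diff hB φ ψ
  rw [← Nat.card_coe_set_eq]
  refine Nat.card_eq_of_bijective
    (fun ψ => ⟨f ψ, apply_diff_eq_zero hB (hf ψ)⟩) ⟨fun ψ χ h => ?_, fun c => ?_⟩
  · refine Subtype.ext (QuadraticMap.ext fun x => ?_)
    rw [hf ψ, hf χ, Subtype.mk.inj h]
  · obtain ⟨ψ, hψ⟩ := exists_translate_eq_add hB φ c.2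
    refine ⟨ψ, Subtype.ext (diff_unique hB fun x => ?_)⟩
    have := hf ψ x
    rw [hψ x] at this
    exact (add_left_cancel this).symm

end QuadForms

theorem two_mul_natCard_quadForms {V : Type*} [AddCommGroup V] [Module (ZMod 2) V] [Fintype V]
    {B : LinearMap.BilinForm (ZMod 2) V} {ε : FormType} (hB : IsSymplectic B)
    (φ : quadForms B ε) :
    2 * (Nat.card (quadForms B ε) : ℤ) = Nat.card V + gaussSum2 φ.1 := by
  classical
  have hval : ∀ x, sgn (φ.1 x) = 2 * (if φ.1 x = 0 then 1 else 0) - 1 := by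
    intro x
    unfold sgn
    split_ifs <;> norm_num
  rw [natCard_quadForms hB φ, gaussSum2, Finset.sum_congr rfl fun x _ => hval x,
    Finset.sum_sub_distrib, ← Finset.mul_sum, Finset.sum_boole, Set.ncard_eq_toFinset_card']
  simp

/-! ### Symplectic forms in characteristic two -/

section Symplectic

variable {K V : Type*} [Field K] [AddCommGroup V] [Module K V] {B' : LinearMap.BilinForm K V}

theorem IsSymplectic.symm [CharP K 2] (hB' : IsSymplectic B') (u v : V) : B' u v = B' v u := by
  rw [← hB'.2.neg_eq u v, CharTwo.neg_eq]

theorem exists_apply_eq (hB' : IsSymplectic B') {c : V} (hc : c ≠ 0) (β : K) :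
    ∃ d, B' c d = β := by
  obtain ⟨d, hd⟩ : ∃ d, B' c d ≠ 0 := by
    by_contra! h
    exact hc (hB'.1.1 c h)
  exact ⟨(β / B' c d) • d, by rw [map_smul, smul_eq_mul, div_mul_cancel₀ _ hd]⟩

end Symplectic

/-! ### Lifting quadratic forms to the extension field -/

section Lift

variable {K V : Type*} [Field K] [Algebra (ZMod 2) K] [AddCommGroup V]
  [Module (ZMod 2) V] [Module K V]

/-- `Q` is the lift of the `𝔽₂`-quadratic form `φ` to `K`: the `K`-quadratic form, regarded as a
function on `V`, that satisfies `φ = Tr ∘ Q`. The condition `Tr (a² Q x) = φ (a x)` for all `a`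
determines `Q` and implies that it is a `K`-quadratic form; see `IsTraceLift.map_smul` and
`IsTraceLift.map_add`. -/
def IsTraceLift (φ : QuadraticForm (ZMod 2) V) (Q : V → K) : Prop :=
  ∀ (a : K) (x : V), Algebra.trace (ZMod 2) K (a ^ 2 * Q x) = φ (a • x)

theorem IsTraceLift.trace_apply {φ : QuadraticForm (ZMod 2) V} {Q : V → K} (h : IsTraceLift φ Q)
    (x : V) : Algebra.trace (ZMod 2) K (Q x) = φ x := by
  simpa using h 1 x

variable {B : LinearMap.BilinForm (ZMod 2) V} {B' : LinearMap.BilinForm K V} {ε : FormType}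

/-- Along a `K`-line the form `φ` is additive, because the line is totally isotropic. -/
theorem exists_linear_smul (hB' : IsSymplectic B')
    (htr : ∀ u v, B u v = Algebra.trace (ZMod 2) K (B' u v)) (φ : quadForms B ε) (x : V) :
    ∃ f : K →ₗ[ZMod 2] ZMod 2, ∀ a : K, f a = φ.1 (a • x) :=
  ⟨AddMonoidHom.toZModLinearMap 2
    { toFun := fun a : K => φ.1 (a • x)
      map_zero' := by simp
      map_add' := fun a b => by
        rw [add_smul, quadForms_add, htr]
        simp [hB'.2 x] }, fun _ => rfl⟩

/-- Transport of a lift by a semi-isometry. -/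
theorem IsTraceLift.translate {φ : QuadraticForm (ZMod 2) V} {Q : V → K} (hQ : IsTraceLift φ Q)
    {g : V ≃ₗ[ZMod 2] V} {σ : K ≃+* K} (hσ : ∀ (a : K) (v : V), g (a • v) = σ a • g v) :
    IsTraceLift (translate g φ) fun x => σ (Q (g⁻¹ x)) := by
  intro a x
  obtain ⟨a, rfl⟩ := σ.surjective a
  obtain ⟨x, rfl⟩ := g.surjective x
  have hg : ∀ v, g⁻¹ (g v) = v := fun v => g.symm_apply_apply v
  beta_reduce
  rw [translate_apply, ← hσ, hg, hg, ← hQ a x, ← map_pow, ← map_mul, trace_ringEquiv]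

variable [Finite K]

theorem exists_isTraceLift (hB' : IsSymplectic B')
    (htr : ∀ u v, B u v = Algebra.trace (ZMod 2) K (B' u v)) (φ : quadForms B ε) :
    ∃ Q : V → K, IsTraceLift φ.1 Q := by
  choose f hf using exists_linear_smul hB' htr φ
  choose Q hQ using fun x => exists_trace_sq_mul (f x)
  exact ⟨Q, fun a x => by rw [hQ, hf]⟩

theorem IsTraceLift.map_smul {φ : QuadraticForm (ZMod 2) V} {Q : V → K} (hQ : IsTraceLift φ Q)
    (c : K) (x : V) : Q (c • x) = c ^ 2 * Q x :=
  ext_trace_sq_mul fun a => by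
    rw [hQ, ← mul_assoc, ← mul_pow, hQ, smul_smul]

theorem IsTraceLift.map_add (htr : ∀ u v, B u v = Algebra.trace (ZMod 2) K (B' u v))
    {φ : quadForms B ε} {Q : V → K} (hQ : IsTraceLift φ.1 Q) (x y : V) :
    Q (x + y) = Q x + Q y + B' x y :=
  ext_trace_sq_mul fun a => by
    rw [hQ, mul_add, mul_add, _root_.map_add, _root_.map_add, hQ, hQ, smul_add, quadForms_add, htr]
    simp only [_root_.map_smul, LinearMap.smul_apply, smul_eq_mul]
    congr 2
    ring

theorem IsTraceLift.unique {φ : QuadraticForm (ZMod 2) V} {Q Q' : V → K} (hQ : IsTraceLift φ Q)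
    (hQ' : IsTraceLift φ Q') : Q = Q' :=
  funext fun x => ext_trace_sq_mul fun a => by rw [hQ, hQ']

theorem IsTraceLift.add (htr : ∀ u v, B u v = Algebra.trace (ZMod 2) K (B' u v))
    {φ ψ : quadForms B ε} {Q : V → K} (hQ : IsTraceLift φ.1 Q) {d : V}
    (hψ : ∀ x, ψ.1 x = φ.1 x + B d x) : IsTraceLift ψ.1 fun x => Q x + B' d x ^ 2 := by
  intro a x
  rw [mul_add, _root_.map_add, hQ, ← mul_pow, trace_sq, hψ, htr,
    (B' d).map_smul, smul_eq_mul]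

/-! ### The colour of the pairs separated by a codeword -/

/-- The colour `Q c` of a pair `φ`, `φ + B c` is the same, up to automorphisms of `K`, for all pairs
that a codeword separates. -/
theorem exists_colour_eq [Finite V] (hB : IsSymplectic B) {φ ψ φ' ψ' : quadForms B ε} {g : Sp B}
    (hg : g.1 ∈ GammaSp B') (hφ : g • φ = φ') (hψ : g • ψ = ψ')
    {c c' : V} (hc : ∀ x, ψ.1 x = φ.1 x + B c x) (hc' : ∀ x, ψ'.1 x = φ'.1 x + B c' x)
    {Q Q' : V → K} (hQ : IsTraceLift φ.1 Q) (hQ' : IsTraceLift φ'.1 Q') :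
    ∃ σ : K ≃+* K, Q' c' = σ (Q c) := by
  obtain ⟨σ, hσ, -⟩ := hg
  have h1 : c' = g.1 c := by
    refine diff_unique hB fun x => ?_
    have h := hc' x
    rw [← hφ, ← hψ, smul_quadForms_apply, smul_quadForms_apply, hc] at h
    rw [← add_left_cancel h, ← g.2]
    congr 1
    exact g.1.apply_symm_apply x
  subst hφ
  refine ⟨σ, ?_⟩
  rw [hQ'.unique (hQ.translate hσ), h1]
  exact congrArg (fun v => σ (Q v)) (g.1.symm_apply_apply c)

/-- Let `φ` lie in `Δ` and `ψ = φ + B c` outside. Then for any `d` with `Tr (Q d) = 0` the form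
`φ + B d` forms with one of `φ`, `ψ` a separated pair, whose colour is that of `φ`, `ψ` up to
`Aut K`. -/
theorem colour_intermediate [Finite V] (hB : IsSymplectic B) (hB' : IsSymplectic B')
    (htr : ∀ u v, B u v = Algebra.trace (ZMod 2) K (B' u v)) {Δ : Set (quadForms B ε)}
    (hΔ : ∀ φ ∈ Δ, ∀ ψ ∉ Δ, ∀ φ' ∈ Δ, ∀ ψ' ∉ Δ,
      ∃ g : Sp B, g.1 ∈ GammaSp B' ∧ g • φ = φ' ∧ g • ψ = ψ')
    {φ ψ : quadForms B ε} (hφ : φ ∈ Δ) (hψ : ψ ∉ Δ) {c : V} (hc : ∀ x, ψ.1 x = φ.1 x + B c x)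
    {Q : V → K} (hQ : IsTraceLift φ.1 Q) {d : V} (hd : Algebra.trace (ZMod 2) K (Q d) = 0) :
    (∃ σ : K ≃+* K, Q d = σ (Q c)) ∨
      ∃ σ : K ≃+* K, Q c + Q d + (B' c d + B' c d ^ 2) = σ (Q c) := by
  have := charTwo_of_algebra K
  rw [hQ.trace_apply] at hd
  obtain ⟨χ, hχ⟩ := exists_translate_eq_add hB φ hd
  by_cases h : χ ∈ Δ
  · right
    obtain ⟨g, hg, h1, h2⟩ := hΔ φ hφ ψ hψ χ h ψ hψ
    have hc' : ∀ x, ψ.1 x = χ.1 x + B (c + d) x := fun x => by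
      rw [hc, hχ, _root_.map_add, LinearMap.add_apply]
      have : ∀ a b c : ZMod 2, a + b = a + c + (b + c) := by decide
      exact this _ _ _
    obtain ⟨σ, hσ⟩ := exists_colour_eq hB hg h1 h2 hc hc' hQ (hQ.add htr hχ)
    refine ⟨σ, ?_⟩
    rw [← hσ, hQ.map_add htr, _root_.map_add, hB'.2 d, hB'.symm d c]
    ring
  · left
    obtain ⟨g, hg, h1, h2⟩ := hΔ φ hφ ψ hψ φ hφ χ h
    exact exists_colour_eq hB hg h1 h2 hc hχ hQ hQ

end Lift

/-! ### Vectors with prescribed values of a quadratic form -/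

section Values

variable {K V : Type*} [Field K] [Finite K] [Algebra (ZMod 2) K] [AddCommGroup V]
  [Module (ZMod 2) V] [Module K V] {B : LinearMap.BilinForm (ZMod 2) V}
  {B' : LinearMap.BilinForm K V} {ε : FormType}

/-- A vector `c` and a nonzero singular vector `s` admit a singular vector `d` with prescribed
`B' c d`. -/
theorem exists_singular_apply_eq (hB' : IsSymplectic B')
    (htr : ∀ u v, B u v = Algebra.trace (ZMod 2) K (B' u v)) {φ : quadForms B ε} {Q : V → K}
    (hQ : IsTraceLift φ.1 Q) {c s : V} (hc : c ≠ 0) (hs : s ≠ 0) (hQs : Q s = 0) (β : K) :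
    ∃ d, B' c d = β ∧ Q d = 0 := by
  have := charTwo_of_algebra K
  -- It suffices that some singular vector is not perpendicular to `c`.
  suffices h : ∃ d, B' c d ≠ 0 ∧ Q d = 0 by
    obtain ⟨d, h1, h2⟩ := h
    exact ⟨(β / B' c d) • d, by rw [map_smul, smul_eq_mul, div_mul_cancel₀ _ h1],
      by rw [hQ.map_smul, h2, mul_zero]⟩
  by_cases hcs : B' c s = 0
  · obtain ⟨d₀, hd₀, hsd₀⟩ : ∃ d₀, B' c d₀ ≠ 0 ∧ B' s d₀ ≠ 0 := by
      obtain ⟨u, hu⟩ := exists_apply_eq hB' hc 1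
      obtain ⟨v, hv⟩ := exists_apply_eq hB' hs 1
      by_cases h1 : B' s u = 0
      · by_cases h2 : B' c v = 0
        · exact ⟨u + v, by simp [hu, h2], by simp [hv, h1]⟩
        · exact ⟨v, h2, by simp [hv]⟩
      · exact ⟨u, by simp [hu], h1⟩
    refine ⟨d₀ + (Q d₀ / B' s d₀) • s, ?_, ?_⟩
    · rwa [map_add, map_smul, hcs, smul_zero, add_zero]
    · rw [hQ.map_add htr, hQ.map_smul, hQs, mul_zero, add_zero, map_smul, smul_eq_mul,
        hB'.symm d₀ s, div_mul_cancel₀ _ hsd₀, CharTwo.add_self_eq_zero]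
  · exact ⟨s, hcs, hQs⟩

/-- For anisotropic `Q`, whether `Q` takes the value `μ` on the affine line of the `d₀ + t c` is
governed by a trace, and `0` is not taken. -/
theorem exists_apply_eq_of_anisotropic (hB' : IsSymplectic B')
    (htr : ∀ u v, B u v = Algebra.trace (ZMod 2) K (B' u v)) {φ : quadForms B ε} {Q : V → K}
    (hQ : IsTraceLift φ.1 Q) (hanis : ∀ s, Q s = 0 → s = 0) {c : V} (hc : c ≠ 0) {β μ : K}
    (hβ : β ≠ 0) (hμ : Algebra.trace (ZMod 2) K (Q c * μ / β ^ 2) = 1) :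
    ∃ d, B' c d = β ∧ Q d = μ := by
  have := charTwo_of_algebra K
  obtain ⟨d₀, hd₀⟩ := exists_apply_eq hB' hc β
  have hQc : Q c ≠ 0 := fun h => hc (hanis c h)
  -- Substituting `t = β s / Q c` reduces `Q (d₀ + t c) = ν` to an equation for `s + s ^ 2`.
  have key : ∀ ν, Algebra.trace (ZMod 2) K (Q c * (ν + Q d₀) / β ^ 2) = 0 →
      ∃ d, B' c d = β ∧ Q d = ν := by
    intro ν hν
    obtain ⟨s, hs⟩ := exists_add_sq_eq hν
    refine ⟨d₀ + (β * s / Q c) • c, ?_, ?_⟩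
    · rw [map_add, map_smul, hB'.2 c, smul_zero, add_zero, hd₀]
    · rw [hQ.map_add htr, hQ.map_smul, map_smul, hB'.symm d₀ c, hd₀, smul_eq_mul]
      have h1 : (β * s / Q c) ^ 2 * Q c + β * s / Q c * β = β ^ 2 / Q c * (s + s ^ 2) := by
        field_simp
        ring
      rw [add_assoc, h1, hs]
      have h2 : β ^ 2 / Q c * (Q c * (ν + Q d₀) / β ^ 2) = ν + Q d₀ := by
        field_simp
      rw [h2, add_comm, add_assoc, CharTwo.add_self_eq_zero, add_zero]
  -- The value `0` is not taken, so the trace for `ν = 0` is one.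
  have h0 : Algebra.trace (ZMod 2) K (Q c * (0 + Q d₀) / β ^ 2) ≠ 0 := fun h => by
    obtain ⟨d, h1, h2⟩ := key 0 h
    rw [hanis d h2, map_zero] at h1
    exact hβ h1.symm
  refine key μ ?_
  have h1 : ∀ u : ZMod 2, u ≠ 0 → 1 + u = 0 := by decide
  have h2 := h1 _ h0
  rw [← hμ, ← map_add] at h2
  rw [← h2]
  congr 1
  ring

/-- An anisotropic space over a finite field of characteristic two has dimension at most two:
perpendicular vectors are proportional, since `Q (u + t e) = Q u + t ^ 2 Q e` for `u ⟂ e` and all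
elements of `K` are squares. -/
theorem finrank_le_two_of_anisotropic [FiniteDimensional K V]
    (htr : ∀ u v, B u v = Algebra.trace (ZMod 2) K (B' u v)) {φ : quadForms B ε} {Q : V → K}
    (hQ : IsTraceLift φ.1 Q) (hanis : ∀ s, Q s = 0 → s = 0) : Module.finrank K V ≤ 2 := by
  have := charTwo_of_algebra K
  by_cases hc : ∃ c : V, c ≠ 0
  swap
  · push Not at hc
    have : Subsingleton V := ⟨fun x y => by rw [hc x, hc y]⟩
    simp [Module.finrank_zero_of_subsingleton]
  obtain ⟨c, hc⟩ := hc
  have hle : LinearMap.ker (B' c) ≤ Submodule.span K {c} := by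
    intro u hu
    rw [LinearMap.mem_ker] at hu
    have hQc : Q c ≠ 0 := fun h => hc (hanis c h)
    obtain ⟨t, ht⟩ := exists_sq_eq (Q u / Q c)
    have h0 : t • c + u = 0 := hanis _ <| by
      rw [hQ.map_add htr, hQ.map_smul, ht, div_mul_cancel₀ _ hQc, map_smul, LinearMap.smul_apply,
        hu, smul_zero, add_zero, CharTwo.add_self_eq_zero]
    rw [Submodule.mem_span_singleton]
    exact ⟨-t, by rw [neg_smul]; exact neg_eq_of_add_eq_zero_right h0⟩
  have h1 := Submodule.finrank_mono hle
  rw [finrank_span_singleton hc] at h1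
  have h2 := LinearMap.finrank_range_add_finrank_ker (B' c)
  have h3 := Submodule.finrank_le (LinearMap.range (B' c))
  rw [Module.finrank_self] at h3
  omega

/-- The Gauss sum of `Tr ∘ Q` for anisotropic `Q` on a plane, summed along the `K`-lines, on
each of which the form is a nonzero linear functional. -/
theorem gaussSum2_of_anisotropic [Fintype V] (hB' : IsSymplectic B')
    (htr : ∀ u v, B u v = Algebra.trace (ZMod 2) K (B' u v)) {φ : quadForms B ε} {Q : V → K}
    (hQ : IsTraceLift φ.1 Q) (hanis : ∀ s, Q s = 0 → s = 0) (hV : Module.finrank K V = 2) :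
    gaussSum2 φ.1 = -Nat.card K := by
  classical
  have := Fintype.ofFinite K
  have hcard : Fintype.card V = Fintype.card K ^ 2 := by
    have := Module.card_eq_pow_finrank (K := K) (V := V)
    rwa [hV] at this
  have h1 : ∑ a : K, ∑ x : V, sgn (φ.1 (a • x)) =
      (Fintype.card K : ℤ) ^ 2 + (Fintype.card K - 1) * gaussSum2 φ.1 := by
    have ha : ∀ a : K, ∑ x : V, sgn (φ.1 (a • x)) =
        gaussSum2 φ.1 + if a = 0 then (Fintype.card K : ℤ) ^ 2 - gaussSum2 φ.1 else 0 := by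
      intro a
      split_ifs with h
      · simp [h, hcard]
      · rw [add_zero]
        exact Fintype.sum_equiv (LinearEquiv.smulOfNeZero K V a h).toEquiv _ _ fun x => rfl
    rw [Finset.sum_congr rfl fun a _ => ha a, Finset.sum_add_distrib, Finset.sum_ite_eq']
    simp
    ring
  have h2 : ∑ a : K, ∑ x : V, sgn (φ.1 (a • x)) = Fintype.card K := by
    rw [Finset.sum_comm, Finset.sum_eq_single 0]
    · simp
    · intro x _ hx
      obtain ⟨f, hf⟩ := exists_linear_smul hB' htr φ x
      rw [Finset.sum_congr rfl fun a _ => by rw [← hf]]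
      refine sum_sgn_eq_zero fun h => hx (hanis x (eq_zero_of_trace_sq_mul fun a => ?_))
      rw [hQ, ← hf, h, LinearMap.zero_apply]
    · simp
  have h3 : (Fintype.card K : ℤ) - 1 ≠ 0 := by
    have := Fintype.one_lt_card (α := K)
    omega
  rw [Nat.card_eq_fintype_card]
  refine mul_left_cancel₀ h3 ?_
  linear_combination h2 - h1

end Values

/-! ### Elimination of all but small anisotropic planes -/

section Elimination

variable {K V : Type*} [Field K] [Finite K] [Algebra (ZMod 2) K] [AddCommGroup V]
  [Module (ZMod 2) V] [Module K V] {B : LinearMap.BilinForm (ZMod 2) V}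
  {B' : LinearMap.BilinForm K V} {ε : FormType} {φ : quadForms B ε} {Q : V → K} {c : V}

/-- The colour is not zero: otherwise some `d` with `B' c d = 1` and `Q d = μ ≠ 0` of trace zero
would contradict `colour_intermediate`. -/
theorem colour_ne_zero (hB' : IsSymplectic B')
    (htr : ∀ u v, B u v = Algebra.trace (ZMod 2) K (B' u v)) (hQ : IsTraceLift φ.1 Q) (hc : c ≠ 0)
    (hstep : ∀ d, Algebra.trace (ZMod 2) K (Q d) = 0 → (∃ σ : K ≃+* K, Q d = σ (Q c)) ∨
      ∃ σ : K ≃+* K, Q c + Q d + (B' c d + B' c d ^ 2) = σ (Q c))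
    (hK : 2 < Nat.card K) : Q c ≠ 0 := by
  intro h0
  have := charTwo_of_algebra K
  have hcard := two_mul_ncard_trace_eq (K := K) 0
  obtain ⟨μ, hμ, hμ0⟩ := Set.exists_ne_of_one_lt_ncard
    (show 1 < {x : K | Algebra.trace (ZMod 2) K x = 0}.ncard by omega) 0
  obtain ⟨d₀, hd₀⟩ := exists_apply_eq hB' hc 1
  -- As `c` is singular, `Q` is affine and nonconstant on the line of the `d₀ + t c`.
  have hval : Q (d₀ + (μ + Q d₀) • c) = μ := by
    rw [hQ.map_add htr, hQ.map_smul, h0, map_smul, hB'.symm d₀ c, hd₀, smul_eq_mul, mul_one,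
      mul_zero, add_zero, add_comm μ, ← add_assoc, CharTwo.add_self_eq_zero, zero_add]
  have hβ : B' c (d₀ + (μ + Q d₀) • c) = 1 := by
    rw [map_add, map_smul, hB'.2 c, smul_zero, add_zero, hd₀]
  have h := hstep (d₀ + (μ + Q d₀) • c) (by rw [hval]; exact hμ)
  rw [hval, hβ, h0, one_pow, CharTwo.add_self_eq_zero, zero_add, add_zero] at h
  simp only [map_zero, exists_const, or_self] at h
  exact hμ0 h

/-- If `Q` had a nonzero singular vector, a singular `d` with `β + β ^ 2 = Q c` for `β = B' c d`
would contradict `colour_intermediate`. -/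
theorem anisotropic_of_colour (hB' : IsSymplectic B')
    (htr : ∀ u v, B u v = Algebra.trace (ZMod 2) K (B' u v)) (hQ : IsTraceLift φ.1 Q)
    (hφc : φ.1 c = 0)
    (hstep : ∀ d, Algebra.trace (ZMod 2) K (Q d) = 0 → (∃ σ : K ≃+* K, Q d = σ (Q c)) ∨
      ∃ σ : K ≃+* K, Q c + Q d + (B' c d + B' c d ^ 2) = σ (Q c))
    (hQc : Q c ≠ 0) (s : V) (hs : Q s = 0) : s = 0 := by
  have := charTwo_of_algebra K
  by_contra hs0
  have hc : c ≠ 0 := by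
    rintro rfl
    exact hQc (by simpa using hQ.map_smul 0 0)
  obtain ⟨β, hβ⟩ := exists_add_sq_eq (x := Q c) (by rw [hQ.trace_apply, hφc])
  obtain ⟨d, hd, hQd⟩ := exists_singular_apply_eq hB' htr hQ hc hs0 hs β
  have h := hstep d (by rw [hQd, map_zero])
  rw [hQd, hd, hβ, add_zero, CharTwo.add_self_eq_zero] at h
  have hne : ¬ ∃ σ : K ≃+* K, 0 = σ (Q c) := by
    rintro ⟨σ, h⟩
    exact hQc ((map_eq_zero σ).1 h.symm)
  exact h.elim hne hne

/-- In the anisotropic case the field is small. Fix `μ` of trace zero outside the orbit of the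
colour `Q c`, which has at most `[K : 𝔽₂]` elements. Half of the elements `x` of `K` have trace one,
each yields a `β` with `Q c * μ / β ^ 2 = x` and then a `d` with `Q d = μ` and `B' c d = β`, and the map
from `x` to the colour `Q c + μ + β + β ^ 2` is at most two-to-one, with values in that orbit. -/
theorem natCard_le_of_anisotropic (hB' : IsSymplectic B')
    (htr : ∀ u v, B u v = Algebra.trace (ZMod 2) K (B' u v)) (hQ : IsTraceLift φ.1 Q)
    (hstep : ∀ d, Algebra.trace (ZMod 2) K (Q d) = 0 → (∃ σ : K ≃+* K, Q d = σ (Q c)) ∨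
      ∃ σ : K ≃+* K, Q c + Q d + (B' c d + B' c d ^ 2) = σ (Q c))
    (hQc : Q c ≠ 0) (hanis : ∀ s, Q s = 0 → s = 0) :
    Nat.card K ≤ 4 * Module.finrank (ZMod 2) K := by
  classical
  have := charTwo_of_algebra K
  by_contra! hlt
  have hc : c ≠ 0 := by
    rintro rfl
    exact hQc (by simpa using hQ.map_smul 0 0)
  have hb : 0 < Module.finrank (ZMod 2) K := Module.finrank_pos
  have : Finite (K ≃+* K) := Finite.of_injective _ DFunLike.coe_injective
  set Λ : Set K := Set.range fun σ : K ≃+* K => σ (Q c) with hΛ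
  have hΛcard : Λ.ncard ≤ Module.finrank (ZMod 2) K := by
    rw [← natCard_ringAut K, ← Nat.card_coe_set_eq]
    exact Finite.card_range_le _
  obtain ⟨μ, hμ, hμΛ⟩ : ∃ μ ∈ {x : K | Algebra.trace (ZMod 2) K x = 0}, μ ∉ insert 0 Λ := by
    refine Set.exists_mem_notMem_of_ncard_lt_ncard ?_
    have h1 := two_mul_ncard_trace_eq (K := K) 0
    have h2 := Set.ncard_insert_le 0 Λ
    omega
  rw [Set.mem_insert_iff, not_or] at hμΛ
  obtain ⟨hμ0, hμΛ⟩ := hμΛ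
  have hex : ∀ x : K, ∃ β : K, Algebra.trace (ZMod 2) K x = 1 →
      Q c * μ / β ^ 2 = x ∧ Q c + μ + (β + β ^ 2) ∈ Λ := by
    intro x
    obtain ⟨β, hβ⟩ := exists_sq_eq (Q c * μ / x)
    refine ⟨β, fun hx => ?_⟩
    have hx0 : x ≠ 0 := by
      rintro rfl
      simp at hx
    have hβ0 : β ≠ 0 := by
      rintro rfl
      rw [zero_pow two_ne_zero] at hβ
      exact div_ne_zero (mul_ne_zero hQc hμ0) hx0 hβ.symm
    have hβx : Q c * μ / β ^ 2 = x := by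
      rw [hβ]
      field_simp
    refine ⟨hβx, ?_⟩
    obtain ⟨d, hd, hQd⟩ := exists_apply_eq_of_anisotropic hB' htr hQ hanis hc hβ0
      (hβx.symm ▸ hx : Algebra.trace (ZMod 2) K (Q c * μ / β ^ 2) = 1)
    have h := hstep d (by rw [hQd]; exact hμ)
    rw [hQd, hd] at h
    rcases h with ⟨σ, h⟩ | ⟨σ, h⟩
    · exact absurd ⟨σ, h.symm⟩ hμΛ
    · exact ⟨σ, h.symm⟩
  choose f hf using hex
  have hfin : Fintype K := Fintype.ofFinite K
  have h1 := two_mul_ncard_trace_eq (K := K) 1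
  rw [Set.ncard_eq_toFinset_card'] at h1
  set E := {x : K | Algebra.trace (ZMod 2) K x = 1}.toFinset
  have hE : ∀ x ∈ E, Algebra.trace (ZMod 2) K x = 1 := fun x hx => by simpa [E] using hx
  have h2 := Finset.card_le_mul_card_image (f := fun x => Q c + μ + (f x + f x ^ 2)) E 2 (by
    intro y hy
    obtain ⟨x₀, hx₀, rfl⟩ := Finset.mem_image.1 hy
    refine (Finset.card_le_card (t := {x₀, Q c * μ / (f x₀ + 1) ^ 2}) fun x hx => ?_).trans
      Finset.card_le_two
    rw [Finset.mem_filter] at hx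
    have h3 := add_left_cancel hx.2
    have h4 : (f x + f x₀) * (f x + (f x₀ + 1)) = 0 := by
      -- `f x` and `f x₀` are roots of the same equation `β + β ^ 2 = const`.
      have e1 : (f x + f x₀) * (f x + (f x₀ + 1)) =
          (f x + f x ^ 2) + (f x₀ + f x₀ ^ 2) + 2 * (f x * f x₀) := by ring
      rw [e1, h3, CharTwo.add_self_eq_zero, CharTwo.two_eq_zero]
      ring
    rw [Finset.mem_insert, Finset.mem_singleton]
    rcases mul_eq_zero.1 h4 with h | h
    · left
      rw [← (hf x (hE x hx.1)).1, ← (hf x₀ (hE x₀ hx₀)).1, CharTwo.add_eq_zero.1 h]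
    · right
      rw [← (hf x (hE x hx.1)).1, CharTwo.add_eq_zero.1 h])
  have h3 : (E.image fun x => Q c + μ + (f x + f x ^ 2)).card ≤ Λ.ncard := by
    rw [← Set.ncard_coe_finset]
    refine Set.ncard_le_ncard fun y hy => ?_
    obtain ⟨x, hx, rfl⟩ := Finset.mem_image.1 (Finset.mem_coe.1 hy)
    exact (hf x (hE x hx)).2
  omega

end Elimination

/-! ### The order of the semi-isometry group of a plane -/

section Order

theorem natCard_ker_det (K : Type*) [Field K] [Finite K] :
    Nat.card (Matrix.GeneralLinearGroup.det : GL (Fin 2) K →* Kˣ).ker =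
      Nat.card K * (Nat.card K ^ 2 - 1) := by
  have := Fintype.ofFinite K
  have hq : 1 < Nat.card K := Finite.one_lt_card
  have h1 := (Matrix.GeneralLinearGroup.det : GL (Fin 2) K →* Kˣ).ker.card_mul_index
  rw [Subgroup.index_ker, MonoidHom.range_eq_top.2 Matrix.GeneralLinearGroup.det_surjective,
    Subgroup.card_top, Nat.card_units, Matrix.card_GL_field, Fin.prod_univ_two,
    ← Nat.card_eq_fintype_card] at h1
  obtain ⟨r, hr⟩ := Nat.exists_eq_add_of_lt hq
  refine Nat.eq_of_mul_eq_mul_right (show 0 < Nat.card K - 1 by omega) (h1.trans ?_)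
  have h2 : Nat.card K ^ 2 - Nat.card K = Nat.card K * (Nat.card K - 1) := by
    rw [sq, Nat.mul_sub_one]
  simp only [Fin.val_zero, Fin.val_one, pow_zero, pow_one, h2]
  ring

variable {K V : Type*} [Field K] [AddCommGroup V]
  [Module K V] {B' : LinearMap.BilinForm K V}

/-- In characteristic two, isometries have determinant one, for the determinant has square one. -/
theorem det_of_mem_Sp [CharP K 2] (hB' : IsSymplectic B') {ι : Type*} [Fintype ι] [DecidableEq ι]
    (b : Module.Basis ι K V) {g : V ≃ₗ[K] V} (hg : g ∈ Sp B') :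
    (LinearMap.toMatrix b b g.toLinearMap).det = 1 := by
  have h1 : B'.comp g.toLinearMap g.toLinearMap = B' := by
    ext u v
    exact hg u v
  have h2 := LinearMap.BilinForm.toMatrix_comp b b B' g.toLinearMap g.toLinearMap
  rw [h1] at h2
  have h3 := congrArg Matrix.det h2
  rw [Matrix.det_mul, Matrix.det_mul, Matrix.det_transpose] at h3
  have h4 := (LinearMap.BilinForm.nondegenerate_iff_det_ne_zero b).1 hB'.1
  have h5 : ((LinearMap.toMatrix b b g.toLinearMap).det + 1) ^ 2 = 0 := by
    refine mul_right_cancel₀ h4 ?_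
    rw [CharTwo.add_sq, one_pow, add_mul, one_mul, zero_mul]
    nth_rewrite 2 [h3]
    rw [CharTwo.add_eq_zero]
    ring
  exact CharTwo.add_eq_zero.1 (pow_eq_zero_iff two_ne_zero |>.1 h5)

variable [Finite K]

theorem natCard_Sp_dvd [CharP K 2] (hB' : IsSymplectic B') (hV : Module.finrank K V = 2) :
    Nat.card (Sp B') ∣ Nat.card K * (Nat.card K ^ 2 - 1) := by
  have : FiniteDimensional K V := Module.finite_of_finrank_pos (by omega)
  let b : Module.Basis (Fin 2) K V := Module.finBasisOfFinrankEq K V hV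
  let ρ : (V ≃ₗ[K] V) →* GL (Fin 2) K :=
    (Units.map (LinearMap.toMatrixAlgEquiv b : (V →ₗ[K] V) →* Matrix (Fin 2) (Fin 2) K)).comp
      (LinearMap.GeneralLinearGroup.generalLinearEquiv K V).symm.toMonoidHom
  have hρ : ∀ g, (ρ g).1 = LinearMap.toMatrix b b g.toLinearMap := fun g => rfl
  have hinj : Function.Injective ρ := fun g h hgh => by
    have := congrArg Units.val hgh
    rw [hρ, hρ] at this
    exact LinearEquiv.toLinearMap_injective ((LinearMap.toMatrix b b).injective this)
  rw [← natCard_ker_det]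
  refine Subgroup.card_dvd_of_injective
    ((ρ.comp (Sp B').subtype).codRestrict _ fun g => ?_) fun g h hgh => ?_
  · rw [MonoidHom.mem_ker]
    exact Units.ext (det_of_mem_Sp hB' b g.2)
  · exact Subtype.ext (hinj (congrArg Subtype.val hgh))

variable [Algebra (ZMod 2) K] [Module (ZMod 2) V]

/-- The semi-isometry group of a plane over `𝔽_q`, `q = 2 ^ b`, has order dividing
`b q (q ^ 2 - 1)`: it maps to the automorphism group of `K`, with kernel the isometry group. -/
theorem natCard_GammaSp_dvd (hB' : IsSymplectic B') (hV : Module.finrank K V = 2) :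
    Nat.card (GammaSp B') ∣
      Module.finrank (ZMod 2) K * (Nat.card K * (Nat.card K ^ 2 - 1)) := by
  have := charTwo_of_algebra K
  have : Nontrivial V := Module.nontrivial_of_finrank_pos (R := K) (by omega)
  choose τ hτ hτB using fun g : GammaSp B' => g.2
  obtain ⟨e, he⟩ := exists_ne (0 : V)
  have huniq : ∀ (g : GammaSp B') (σ : K ≃+* K),
      (∀ u v, B' (g.1 u) (g.1 v) = σ (B' u v)) → σ = τ g := by
    intro g σ hσ
    ext a
    obtain ⟨d, rfl⟩ := exists_apply_eq hB' he a
    rw [← hσ, hτB]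
  let θ : GammaSp B' →* RingAut K := MonoidHom.mk' τ fun g h => by
    refine (huniq (g * h) (τ g * τ h) fun u v => ?_).symm
    change B' (g.1 (h.1 u)) (g.1 (h.1 v)) = _
    rw [hτB, hτB, RingAut.mul_apply]
  have hθ : ∀ g : θ.ker, τ g.1 = 1 := fun g => g.2
  have hlin : ∀ (g : θ.ker) (a : K) (v : V), g.1.1 (a • v) = a • g.1.1 v := fun g a v => by
    rw [hτ g.1, hθ, RingAut.one_apply]
  have hisom : ∀ (g : θ.ker) (u v : V), B' (g.1.1 u) (g.1.1 v) = B' u v := fun g u v => by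
    rw [hτB g.1, hθ, RingAut.one_apply]
  let κ : θ.ker →* Sp B' := MonoidHom.mk' (fun g =>
      ⟨{ g.1.1 with map_smul' := hlin g }, hisom g⟩)
    fun g h => Subtype.ext (LinearEquiv.ext fun _ => rfl)
  have hκ : Function.Injective κ := fun g h hgh => by
    refine Subtype.ext (Subtype.ext (LinearEquiv.ext fun v => ?_))
    exact LinearEquiv.congr_fun (congrArg Subtype.val hgh) v
  rw [← θ.ker.card_mul_index, mul_comm, Subgroup.index_ker]
  refine mul_dvd_mul ?_ ((Subgroup.card_dvd_of_injective κ hκ).trans (natCard_Sp_dvd hB' hV))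
  rw [← natCard_ringAut K]
  exact Subgroup.card_subgroup_dvd_card θ.range

end Order

/-! ### Strongly incidence-transitive codes -/

section Codes

/-- Incidence transitivity makes the stabiliser of `Δ` transitive on a set of size
`|Δ| (|P| - |Δ|)`. -/
theorem ncard_mul_ncard_compl_dvd {G P : Type*} [Group G] [MulAction G P] {k : ℕ}
    {Γ : Set (KSubset P k)} (hΓ : IsStronglyIncidenceTransitive G Γ) {Δ : KSubset P k}
    (hΔ : Δ ∈ Γ) (h₁ : Δ.1.Nonempty) (h₂ : Δ.1ᶜ.Nonempty) :
    Δ.1.ncard * Δ.1ᶜ.ncard ∣ Nat.card (MulAction.stabilizer G Δ) := by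
  obtain ⟨φ, hφ⟩ := h₁
  obtain ⟨ψ, hψ⟩ := h₂
  have hst : ∀ g ∈ MulAction.stabilizer G Δ, g • Δ.1 = Δ.1 := fun g hg =>
    congrArg Subtype.val (MulAction.mem_stabilizer_iff.1 hg)
  have horb : MulAction.orbit (MulAction.stabilizer G Δ) (φ, ψ) = Δ.1 ×ˢ Δ.1ᶜ := by
    ext ⟨x, y⟩
    constructor
    · rintro ⟨g, hg⟩
      rw [← hg]
      have h := hst g.1 g.2
      constructor
      · change g.1 • φ ∈ Δ.1
        rw [← h]
        exact Set.smul_mem_smul_set hφ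
      · change g.1 • ψ ∉ Δ.1
        rw [← h, Set.smul_mem_smul_set_iff]
        exact hψ
    · rintro ⟨hx, hy⟩
      obtain ⟨g, hg, h1, h2⟩ := hΓ.incidence_transitive Δ hΔ φ hφ ψ hψ x hx y hy
      exact ⟨⟨g, hg⟩, Prod.ext h1 h2⟩
  rw [← Set.ncard_prod, ← horb, ← MulAction.index_stabilizer]
  exact Subgroup.index_dvd_card _

variable {V : Type*} [AddCommGroup V] [Module (ZMod 2) V] [Finite V]
  {B : LinearMap.BilinForm (ZMod 2) V} {ε : FormType}

/-- A group preserving a pair `{φ, φ + B c}` of forms fixes the vector `c`. -/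
theorem not_isIrreducibleOn_of_pair (hB : IsSymplectic B) (hV : 1 < Module.finrank (ZMod 2) V)
    {H : Subgroup (Sp B)} {S : Set (quadForms B ε)} (hS : S.ncard = 2)
    (hH : ∀ g ∈ H, g • S = S) : ¬ IsIrreducibleOn (H.map (Sp B).subtype) := by
  rintro ⟨-, hirr⟩
  obtain ⟨φ, ψ, hne, rfl⟩ := Set.ncard_eq_two.1 hS
  obtain ⟨c, hc⟩ := exists_diff hB φ ψ
  have hc0 : c ≠ 0 := by
    rintro rfl
    exact hne (Subtype.ext (QuadraticMap.ext fun x => by rw [hc]; simp))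
  have hfix : ∀ g ∈ H, g.1 c = c := by
    intro g hg
    have hinv : ∀ x, g.1 (g.1⁻¹ x) = x := fun x => g.1.apply_symm_apply x
    have h1 : ∀ x, (g • ψ).1 x = (g • φ).1 x + B (g.1 c) x := fun x => by
      rw [smul_quadForms_apply, smul_quadForms_apply, hc]
      congr 1
      rw [← g.2 c, hinv]
    have hφ : g • φ ∈ ({φ, ψ} : Set (quadForms B ε)) :=
      hH g hg ▸ Set.smul_mem_smul_set (Set.mem_insert _ _)
    have hψ : g • ψ ∈ ({φ, ψ} : Set (quadForms B ε)) :=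
      hH g hg ▸ Set.smul_mem_smul_set (Set.mem_insert_of_mem _ rfl)
    have hne' : g • φ ≠ g • ψ := fun h => hne (MulAction.injective g h)
    refine diff_unique hB fun x => ?_
    have h2 := h1 x
    have h3 := hc x
    rcases hφ with hφ | hφ <;> rcases hψ with hψ | hψ
    · exact absurd (hφ.trans hψ.symm) hne'
    · rw [Set.mem_singleton_iff.1 hψ, hφ, h3] at h2
      exact (add_left_cancel h2).symm
    · rw [Set.mem_singleton_iff.1 hφ, hψ, h3] at h2
      have : ∀ a b c : ZMod 2, a = a + b + c → c = b := by decide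
      exact this _ _ _ h2
    · exact absurd ((Set.mem_singleton_iff.1 hφ).trans (Set.mem_singleton_iff.1 hψ).symm) hne'
  rcases hirr (Submodule.span (ZMod 2) {c}) (by
    rintro _ ⟨g, hg, rfl⟩ u hu
    obtain ⟨a, rfl⟩ := Submodule.mem_span_singleton.1 hu
    have : (Sp B).subtype g (a • c) = a • c := by
      change g.1 (a • c) = a • c
      rw [map_smul, hfix g hg]
    rw [this]
    exact hu) with h | h
  · exact hc0 (Submodule.span_singleton_eq_bot.1 h)
  · have h1 := finrank_span_singleton (K := ZMod 2) hc0
    rw [h, finrank_top] at h1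
    omega

end Codes

end SymplecticCodes

open SymplecticCodes in
theorem theorem5p9 {V : Type*} [AddCommGroup V] [Module (ZMod 2) V]
    (n : ℕ) (hn : 2 ≤ n) (hV : Module.finrank (ZMod 2) V = 2 * n)
    (B : LinearMap.BilinForm (ZMod 2) V) (hB : IsSymplectic B) (ε : FormType)
    (k : ℕ) (hk : 2 ≤ k) (hk' : k + 2 ≤ Nat.card (quadForms B ε))
    (Γ : Set (KSubset (quadForms B ε) k)) (hΓ : IsStronglyIncidenceTransitive (Sp B) Γ)
    (Δ : KSubset (quadForms B ε) k) (hΔ : Δ ∈ Γ)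
    (hirr : IsIrreducibleOn ((MulAction.stabilizer (Sp B) Δ).map (Sp B).subtype))
    (M : Subgroup (Sp B)) (hM : IsMaximalC3Subgroup B M) :
    ¬ MulAction.stabilizer (Sp B) Δ ≤ M := by
  intro hle
  obtain ⟨b, m, hb, hmod, B', hdim, hB', htr, rfl⟩ := hM
  have hVfin : Module.Finite (ZMod 2) V := Module.finite_of_finrank_pos (by omega)
  have : Finite V := Module.finite_of_finite (ZMod 2)
  have := Fintype.ofFinite V
  have hKcard : Nat.card (GaloisField 2 b) = 2 ^ b := GaloisField.card 2 b hb.ne_zero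
  have hKdim : Module.finrank (ZMod 2) (GaloisField 2 b) = b := GaloisField.finrank 2 hb.ne_zero
  have : Finite (GaloisField 2 b) := Nat.finite_of_card_ne_zero (by rw [hKcard]; positivity)
  have : FiniteDimensional (GaloisField 2 b) V := Module.Finite.of_finite
  have : Finite (quadForms B ε) := Nat.finite_of_card_ne_zero (by omega)
  have hcompl : Δ.1ᶜ.ncard = Nat.card (quadForms B ε) - k := by
    rw [Set.ncard_compl, Δ.2]
  have hnon₁ : Δ.1.Nonempty := Set.nonempty_of_ncard_ne_zero (by rw [Δ.2]; omega)
  have hnon₂ : Δ.1ᶜ.Nonempty := Set.nonempty_of_ncard_ne_zero (by rw [hcompl]; omega)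
  obtain ⟨φ, hφ⟩ := hnon₁
  obtain ⟨ψ, hψ⟩ := hnon₂
  obtain ⟨c, hc⟩ := exists_diff hB φ ψ
  obtain ⟨Q, hQ⟩ := exists_isTraceLift hB' htr φ
  have hc0 : c ≠ 0 := by
    rintro rfl
    exact hψ ((Subtype.ext (QuadraticMap.ext fun x => by rw [hc]; simp) : ψ = φ) ▸ hφ)
  have hstep := fun d => colour_intermediate hB hB' htr (Δ := Δ.1)
    (fun φ hφ ψ hψ φ' hφ' ψ' hψ' => by
      obtain ⟨g, hg, h1, h2⟩ := hΓ.incidence_transitive Δ hΔ φ hφ ψ hψ φ' hφ' ψ' hψ'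
      exact ⟨g, hle hg, h1, h2⟩) hφ hψ hc hQ (d := d)
  have hpow : 2 ^ 2 ≤ 2 ^ b := Nat.pow_le_pow_right two_pos hb.two_le
  have hQc := colour_ne_zero hB' htr hQ hc0 hstep (by omega)
  have hanis := anisotropic_of_colour hB' htr hQ (apply_diff_eq_zero hB hc) hstep hQc
  have hplane : Module.finrank (GaloisField 2 b) V = 2 := by
    have h1 := finrank_le_two_of_anisotropic htr hQ hanis
    have h2 : 0 < Module.finrank (GaloisField 2 b) V := by
      have : Nontrivial V := hirr.1
      exact Module.finrank_pos
    omega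
  have hb5 : b < 5 := by
    by_contra! h5
    have h1 := natCard_le_of_anisotropic hB' htr hQ hstep hQc hanis
    rw [hKcard, hKdim] at h1
    have h2 : ∀ j, 5 ≤ j → 4 * j < 2 ^ j := fun j hj => by
      induction j, hj using Nat.le_induction with
      | base => norm_num
      | succ j hj ih => rw [pow_succ]; omega
    exact absurd h1 (not_le.2 (h2 b h5))
  have hcount := two_mul_natCard_quadForms hB φ
  rw [gaussSum2_of_anisotropic hB' htr hQ hanis hplane,
    Module.natCard_eq_pow_finrank (K := GaloisField 2 b) (V := V), hplane, hKcard] at hcount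
  have hdvd : k * (Nat.card (quadForms B ε) - k) ∣ b * (2 ^ b * ((2 ^ b) ^ 2 - 1)) := by
    have h1 := ncard_mul_ncard_compl_dvd hΓ hΔ ⟨φ, hφ⟩ ⟨ψ, hψ⟩
    have h2 := natCard_GammaSp_dvd hB' hplane
    rw [hKcard, hKdim] at h2
    rw [Δ.2, hcompl] at h1
    refine (h1.trans ?_).trans h2
    let ι : MulAction.stabilizer (Sp B) Δ →* GammaSp B' :=
      ((Sp B).subtype.comp (MulAction.stabilizer (Sp B) Δ).subtype).codRestrict _
        fun g => hle g.2
    refine Subgroup.card_dvd_of_injective ι fun g h hgh => Subtype.ext (Subtype.ext ?_)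
    exact (congrArg Subtype.val hgh : (ι g).1 = (ι h).1)
  generalize Nat.card (quadForms B ε) = N at *
  have hst : ∀ g ∈ MulAction.stabilizer (Sp B) Δ, g • Δ.1 = Δ.1 := fun g hg =>
    congrArg Subtype.val (MulAction.mem_stabilizer_iff.1 hg)
  have hb2 := hb.two_le
  interval_cases b
  · -- On the six forms, `3 * 3` does not divide `120`, and pairs are excluded by irreducibility.
    obtain rfl : N = 6 := by push_cast at hcount; omega
    have hk4 : k ≤ 4 := by omega
    interval_cases k
    · exact not_isIrreducibleOn_of_pair hB (by omega) Δ.2 hst hirr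
    · exact absurd hdvd (by decide)
    · refine not_isIrreducibleOn_of_pair hB (by omega) hcompl (fun g hg => ?_) hirr
      rw [Set.smul_set_compl, hst g hg]
  · -- For no `k` does `k * (28 - k)` divide `1512`.
    obtain rfl : N = 28 := by push_cast at hcount; omega
    have hk26 : k ≤ 26 := by omega
    clear * - hk hk26 hdvd
    interval_cases k <;> revert hdvd <;> decide
  · exact absurd hb (by decide)
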